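/- Work in Baire space $\omega^\omega$. A set $A\subseteq\omega^\omega$ is $\mathbf{\Pi}^1_1$ if its complement is analytic. Let ${\sf WO}\subseteq 2^{\omega\times\omega}$ be the set of codes of well-orderings of $\mathbb N$, and let $|y|$ be the order type of $y\in{\sf WO}$. An approximation of a $\mathbf{\Pi}^1_1$ set $A$ is given by a continuous function $o\colon\omega^\omega\to 2^{\omega\times\omega}$ with $A=o^{-1}[{\sf WO}]$; its stage $\alpha\in{\sf WO}$ is $A[\alpha]=\{x\in A:|o(x)|<|\alpha|\}$. For $\ell<\omega$, a double sequence $A=(A^j_n)_{j<\ell,\,n<\omega}$ of $\mathbf{\Pi}^1_1$ sets is an $\omega$-change $\ell\times\omega$ matrix if, for some choice of approximations of the sets $A^j_n$: (1) for every $j<\ell$ the sequence $(A^j_n)_{n<\omega}$ is decreasing; (2) for all $j<k<\ell$, $\alpha\in{\sf WO}$ and $n<\omega$, $A^k_0[\alpha]\cap A^j_n\subseteq A^j_n[\alpha]$. For such $A$, put $v_0(x)=0$ and, for $k<\ell$, let $v_{k+1}(x)$ be the parity ($0$ or $1$) of $\max\{n<\omega:x\in A^k_n\}$ if this maximum exists,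 and $v_{k+1}(x)=v_k(x)$ otherwise. Let ${\sf D}'[A](x)=v_k(x)$ if $k=\min\{j<\ell:x\in\bigcap_{n<\omega}A^j_n\}$ exists, and ${\sf D}'[A](x)=v_\ell(x)$ otherwise. Let $D'_{\ell\times\omega}(\mathbf{\Pi}^1_1)$ be the class of all sets of the form $\{x\in\omega^\omega:{\sf D}'[A](x)=1\}$, where $A$ is an $\omega$-change $\ell\times\omega$ matrix of $\mathbf{\Pi}^1_1$ sets. Lemma. The hierarchy $(D'_{\ell\times\omega}(\mathbf{\Pi}^1_1))_{\ell<\omega}$ does not collapse; that is, for all $k<\ell<\omega$, the difference $D'_{\ell\times\omega}(\mathbf{\Pi}^1_1)\setminus D'_{k\times\omega}(\mathbf{\Pi}^1_1)$ is nonempty. -/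

import Mathlib

/-- Baire space `ω^ω`. -/
abbrev Baire : Type := ℕ → ℕ

/-- A subset of a topological space is (boldface) `Π¹₁`, i.e. coanalytic, if its complement is
analytic. -/
def IsPi11 {X : Type*} [TopologicalSpace X] (A : Set X) : Prop :=
  MeasureTheory.AnalyticSet Aᶜ

/-- The strict part `<_y` of the binary relation `≤_y` on `ℕ` coded by `y ∈ 2^(ω × ω)`,
where `a ≤_y b` means `y (a, b) = 1`. -/
def codeLT (y : ℕ × ℕ → Bool) (a b : ℕ) : Prop :=
  y (a, b) = true ∧ a ≠ b

/-- `WO ⊆ 2^(ω × ω)`: the set of all codes `y` such that `≤_y` is a (reflexive) well-ordering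
of `ℕ`. -/
def WO : Set (ℕ × ℕ → Bool) :=
  {y | (∀ a, y (a, a) = true) ∧ IsWellOrder ℕ (codeLT y)}

/-- The order type `|y|` of a code `y ∈ WO`. -/
noncomputable def WO.otype (y : WO) : Ordinal.{0} :=
  @Ordinal.type ℕ (codeLT y.1) y.2.2

/-- `o` reduces `A` to `WO`: it is continuous and `x ∈ A` if and only if `o x ∈ WO`. Such a
reduction determines the approximation `stage o α` (`α ∈ WO`) of `A`. -/
def ReducesToWO (o : Baire → ℕ × ℕ → Bool) (A : Set Baire) : Prop :=
  Continuous o ∧ ∀ x, x ∈ A ↔ o x ∈ WO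

/-- The stage `α` approximation `A[α]`, for `α ∈ WO`, of the set `A` reduced to `WO` by `o`:
all `x` such that `o x` is a well-order of order type less than `|α|`. -/
def stage (o : Baire → ℕ × ℕ → Bool) (α : WO) : Set Baire :=
  {x | ∃ h : o x ∈ WO, WO.otype ⟨o x, h⟩ < WO.otype α}

/-- `ω`-change `ℓ × ω` matrices of `Π¹₁` sets; `A j n` is the entry `A^j_n` (row `j < ℓ`,
column `n`). -/
def IsOmegaChangeMatrix {ℓ : ℕ} (A : Fin ℓ → ℕ → Set Baire) : Prop :=
  (∀ j n, IsPi11 (A j n)) ∧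
  (∀ j, Antitone (A j)) ∧
  ∃ o : Fin ℓ → ℕ → Baire → ℕ × ℕ → Bool,
    (∀ j n, ReducesToWO (o j n) (A j n)) ∧
    ∀ j k : Fin ℓ, j < k → ∀ α : WO, ∀ n : ℕ,
      stage (o k 0) α ∩ A j n ⊆ stage (o j n) α

open Classical in
/-- The auxiliary parameters `v_k(x)` for `k ≤ ℓ`: `v_0(x) = c`, and `v_{k+1}(x)` is `a^k_m` if
`m` is the maximum of `{n | x ∈ A^k_n}`, and is `v_k(x)` if that maximum does not exist. -/
noncomputable def auxValue {ℓ : ℕ} (c : Fin 2) (a : Fin ℓ → ℕ → Fin 2)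
    (A : Fin ℓ → ℕ → Set Baire) (x : Baire) : Fin (ℓ + 1) → Fin 2 :=
  Fin.induction c fun k v =>
    if h : ∃ m, IsGreatest {n | x ∈ A k n} m then a k h.choose else v

open Classical in
/-- The difference operator applied to `[a/A]` with initial value `c`: its value at `x` is
`v_k(x)` if `k` is the least row with `x ∈ ⋂ n, A^k_n`, and is `v_ℓ(x)` if there is no such
row. -/
noncomputable def diffOp {ℓ : ℕ} (c : Fin 2) (a : Fin ℓ → ℕ → Fin 2)
    (A : Fin ℓ → ℕ → Set Baire) (x : Baire) : Fin 2 :=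
  if h : ∃ k, IsLeast {j : Fin ℓ | x ∈ ⋂ n, A j n} k then auxValue c a A x h.choose.castSucc
  else auxValue c a A x (Fin.last ℓ)

/-- The parity of `n`. -/
def par (n : ℕ) : Fin 2 := if Odd n then 1 else 0

/-- The class `D'_{ℓ×ω}(Π¹₁)` of subsets of Baire space: initial value `c = 0` and
`a^j_n = par n`. A `{0,1}`-valued function is identified with the set on which it is `1`. -/
def DPrime (ℓ : ℕ) : Set (Set Baire) :=
  {P | ∃ A : Fin ℓ → ℕ → Set Baire, IsOmegaChangeMatrix A ∧
    P = {x | diffOp 0 (fun _ n => par n) A x = 1}}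

/-! Non-collapse follows from three facts: the classes increase (`monotone_dPrime`), the complement
of a set at level ℓ lies at level ℓ + 1 (`compl_mem_dPrime_succ`), and some set at level ℓ has its
complement outside level ℓ (`exists_mem_dPrime_compl_notMem`).

The last fact is a diagonal argument. One ω-change matrix `universalMatrix` is such that every
ω-change matrix B has a point p lying in exactly the same entries of both
(`exists_mem_universalMatrix_iff`). The two difference operators then agree at p, so B cannot
compute the complement.

The difficulty is to force the stage condition (2), a comparison of order types, on entries decoded
from an arbitrary p. Order types are replaced by countable transition systems and comparison of
ranks by simulation. The entry for a decoded system V also runs searches for embeddings of the row-k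
systems strictly below a state of V, for all later rows k. Such a search runs forever if V is too
long, removing p from the entry; otherwise it costs no more than a delayed copy of V
(`terminating_guarded`, `guarded_simLE_delay`). Kleene–Brouwer orders turn these systems back into
codes for approximations (`otype_treeCode_le`). -/

/-! ### Simulation as comparison of ranks -/

/-- The transition relation `r` (with `r a b` read as a step from `a` to `b`) has no infinite
path. -/
def Terminating {α : Type*} (r : α → α → Prop) : Prop := WellFounded fun b a => r a b

/-- State `b` of the system `s` simulates state `a` of the system `r`. -/
def Sim {α β : Type*} (r : α → α → Prop) (s : β → β → Prop) (a : α) (b : β) : Prop :=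
  ∃ Q : α → β → Prop, Q a b ∧ ∀ x y, Q x y → ∀ x', r x x' → ∃ y', s y y' ∧ Q x' y'

/-- Every state of `r` is simulated by some state of `s`. -/
def SimLE {α β : Type*} (r : α → α → Prop) (s : β → β → Prop) : Prop := ∀ a, ∃ b, Sim r s a b

/-- Every state of `r` is simulated by a successor of some fixed state of `s`. -/
def StrictBelow {α β : Type*} (r : α → α → Prop) (s : β → β → Prop) : Prop :=
  ∃ b, ∀ a, ∃ b', s b b' ∧ Sim r s a b'

section Simulation

variable {α β γ : Type*} {r : α → α → Prop} {s : β → β → Prop} {t : γ → γ → Prop}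

theorem terminating_iff_isEmpty_path :
    Terminating r ↔ ¬ ∃ f : ℕ → α, ∀ n, r (f n) (f (n + 1)) := by
  rw [Terminating, wellFounded_iff_isEmpty_descending_chain, isEmpty_subtype, not_exists]

theorem Sim.step {a a' : α} {b : β} (h : Sim r s a b) (ha : r a a') :
    ∃ b', s b b' ∧ Sim r s a' b' := by
  obtain ⟨Q, h0, hQ⟩ := h
  obtain ⟨b', hb, hq⟩ := hQ a b h0 a' ha
  exact ⟨b', hb, Q, hq, hQ⟩

theorem Sim.of_step {a : α} {b : β} (h : ∀ a', r a a' → ∃ b', s b b' ∧ Sim r s a' b') :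
    Sim r s a b := by
  refine ⟨fun x y => (x = a ∧ y = b) ∨ Sim r s x y, Or.inl ⟨rfl, rfl⟩, ?_⟩
  rintro x y (⟨rfl, rfl⟩ | hxy) x' hx
  · obtain ⟨y', h1, h2⟩ := h x' hx
    exact ⟨y', h1, Or.inr h2⟩
  · obtain ⟨y', h1, h2⟩ := hxy.step hx
    exact ⟨y', h1, Or.inr h2⟩

theorem Sim.trans {a : α} {b : β} {c : γ} (h : Sim r s a b) (h' : Sim s t b c) :
    Sim r t a c := by
  refine ⟨fun x z => ∃ y, Sim r s x y ∧ Sim s t y z, ⟨b, h, h'⟩, ?_⟩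
  rintro x z ⟨y, hxy, hyz⟩ x' hx
  obtain ⟨y', hy, h1⟩ := hxy.step hx
  obtain ⟨z', hz, h2⟩ := hyz.step hy
  exact ⟨z', hz, y', h1, h2⟩

theorem SimLE.trans (h : SimLE r s) (h' : SimLE s t) : SimLE r t := by
  intro a
  obtain ⟨b, hb⟩ := h a
  obtain ⟨c, hc⟩ := h' b
  exact ⟨c, hb.trans hc⟩

theorem SimLE.of_map (g : α → β) (h : ∀ a a', r a a' → s (g a) (g a')) : SimLE r s := by
  refine fun a => ⟨g a, fun x y => y = g x, rfl, ?_⟩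
  rintro x _ rfl x' hx
  exact ⟨g x', h _ _ hx, rfl⟩

theorem Sim.acc {a : α} {b : β} (hb : Acc (fun y x => s x y) b) (h : Sim r s a b) :
    Acc (fun y x => r x y) a := by
  induction hb generalizing a with
  | intro b _ ih =>
    refine Acc.intro _ fun a' ha => ?_
    obtain ⟨b', hb', hs⟩ := h.step ha
    exact ih b' hb' hs

theorem SimLE.terminating (h : SimLE r s) (hs : Terminating s) : Terminating r :=
  ⟨fun a => by
    obtain ⟨b, hb⟩ := h a
    exact hb.acc (hs.apply b)⟩

theorem StrictBelow.simLE (h : StrictBelow r s) : SimLE r s := by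
  obtain ⟨b, hb⟩ := h
  intro a
  obtain ⟨b', _, h'⟩ := hb a
  exact ⟨b', h'⟩

/-- Ranks are comparable as soon as one system terminates. If a step from a to a' cannot be matched
from b, induction at a' sends every successor of b into a successor of a', so a' itself simulates b.
-/
theorem Terminating.sim_or (hr : Terminating r) (a : α) (b : β) :
    Sim r s a b ∨ ∃ a', r a a' ∧ Sim s r b a' := by
  induction a using hr.induction generalizing b with
  | _ a ih =>
    by_contra hcon
    rw [not_or] at hcon
    refine hcon.1 (Sim.of_step fun a' ha => ?_)
    by_contra hb
    refine hcon.2 ⟨a', ha, Sim.of_step fun b' hbb => ?_⟩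
    refine (ih a' ha b').resolve_left fun hs => hb ⟨b', hbb, hs⟩

theorem Terminating.simLE_or_strictBelow (hr : Terminating r) (s : β → β → Prop) :
    SimLE r s ∨ StrictBelow s r := by
  by_contra hcon
  rw [not_or] at hcon
  refine hcon.1 fun a => ?_
  by_contra ha
  exact hcon.2 ⟨a, fun b => (hr.sim_or a b).resolve_left fun h => ha ⟨b, h⟩⟩

/-- Composing the two simulations would make some state simulated by one of its own successors,
which yields an infinite path. -/
theorem Terminating.not_strictBelow (hr : Terminating r) (h : SimLE r s) :
    ¬ StrictBelow s r := by
  rintro ⟨b, hb⟩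
  have key : ∀ b b', r b b' → ¬ Sim r r b b' := by
    intro b
    induction b using hr.induction with
    | _ b ih =>
      intro b' hb hs
      obtain ⟨b'', hb', hs'⟩ := hs.step hb
      exact ih b' hb b'' hb' hs'
  obtain ⟨c, hc⟩ := h b
  obtain ⟨b', hbb, hs⟩ := hb c
  exact key b b' hbb (hc.trans hs)

end Simulation

/-! ### Searching for an embedding -/

/-- The system `r` in which every step may be preceded by a countdown of arbitrary finite
length. -/
def delay {α : Type*} (r : α → α → Prop) (p q : α × ℕ) : Prop :=
  (p.1 = q.1 ∧ q.2 < p.2) ∨ r p.1 q.1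

theorem Terminating.delay {α : Type*} {r : α → α → Prop} (h : Terminating r) :
    Terminating (delay r) := by
  have hlex := WellFounded.prod_lex h (wellFounded_lt (α := ℕ))
  refine Subrelation.wf (r := Prod.Lex (fun b a => r a b) (· < ·)) ?_ hlex
  rintro ⟨a, m⟩ ⟨b, n⟩ (⟨h1, h2⟩ | h1)
  · cases h1
    exact Prod.Lex.right _ h2
  · exact Prod.Lex.left _ _ h1

theorem simLE_delay {α : Type*} (r : α → α → Prop) : SimLE r (delay r) :=
  SimLE.of_map (fun a => (a, 0)) fun _ _ h => Or.inr h

theorem SimLE.delay {α β : Type*} {r : α → α → Prop} {s : β → β → Prop} (h : SimLE r s) :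
    SimLE (delay r) (delay s) := by
  rintro ⟨a, m⟩
  obtain ⟨b, hb⟩ := h a
  refine ⟨(b, m), fun x y => Sim r s x.1 y.1 ∧ x.2 = y.2, ⟨hb, rfl⟩, ?_⟩
  rintro ⟨x, m⟩ ⟨y, m'⟩ ⟨hs, rfl⟩ ⟨x', n⟩ (⟨h1, h2⟩ | h1)
  · cases h1
    exact ⟨(y, n), Or.inl ⟨rfl, h2⟩, hs, rfl⟩
  · obtain ⟨y', hy, hs'⟩ := hs.step h1
    exact ⟨(y', n), Or.inr hy, hs', rfl⟩

/-- Node `j` of the tree of (reversed) paths of `r` extends node `i` by one state. Nodes need not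
be genuine paths, but the last step has to be a step of `r`. -/
def PathEdge (r : ℕ → ℕ → Prop) (i j : ℕ) : Prop :=
  ∃ t, Denumerable.ofNat (List ℕ) j = t :: Denumerable.ofNat (List ℕ) i ∧
    ∀ h ∈ (Denumerable.ofNat (List ℕ) i).head?, r h t

/-- The list `l` is a finite partial homomorphism from the tree of paths of `r` to `s`. -/
def PartialHom (r s : ℕ → ℕ → Prop) (l : List ℕ) : Prop :=
  ∀ i < l.length, ∀ j < l.length, PathEdge r i j → s (l.getD i 0) (l.getD j 0)

/-- The system that builds a homomorphism from the tree of paths of `r` to `s`, one value at a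
time. -/
def attempt (r s : ℕ → ℕ → Prop) (l l' : List ℕ) : Prop :=
  l ≠ [] ∧ PartialHom r s l' ∧ ∃ v, l' = l ++ [v]

/-- Sending the empty path to b and following the simulation along each path gives a total
homomorphism; its finite restrictions form an infinite run. -/
theorem attempt_not_terminating {r s : ℕ → ℕ → Prop} (h : StrictBelow r s) :
    ¬ Terminating (attempt r s) := by
  obtain ⟨b, hb⟩ := h
  choose g hg hsim using hb
  have hst : ∀ x y x' : ℕ, ∃ y', Sim r s x y → r x x' → s y y' ∧ Sim r s x' y' := by
    intro x y x'
    by_cases h : Sim r s x y ∧ r x x'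
    · obtain ⟨y', h'⟩ := h.1.step h.2
      exact ⟨y', fun _ _ => h'⟩
    · exact ⟨0, fun h1 h2 => absurd ⟨h1, h2⟩ h⟩
  choose c hc using hst
  classical
  -- Nodes need not be genuine paths: where the last step is not a step of `r`, the value restarts
  -- at `g t`, so the value at a node always simulates its head.
  let F : List ℕ → ℕ := fun l => List.rec b (fun t τ v =>
    match τ with
    | [] => g t
    | u :: _ => if r u t then c u v t else g t) l
  have hF : ∀ (t : ℕ) (τ : List ℕ), Sim r s t (F (t :: τ)) := by
    intro t τ
    induction τ generalizing t with
    | nil => exact hsim t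
    | cons u τ ih =>
      change Sim r s t (if r u t then c u (F (u :: τ)) t else g t)
      split_ifs with hut
      · exact (hc u (F (u :: τ)) t (ih u) hut).2
      · exact hsim t
  have hedge : ∀ i j, PathEdge r i j →
      s (F (Denumerable.ofNat (List ℕ) i)) (F (Denumerable.ofNat (List ℕ) j)) := by
    rintro i j ⟨t, hj, hi⟩
    rw [hj]
    generalize Denumerable.ofNat (List ℕ) i = τ at hi
    cases τ with
    | nil => exact hg t
    | cons u τ =>
      have hut : r u t := hi u rfl
      change s (F (u :: τ)) (if r u t then c u (F (u :: τ)) t else g t)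
      rw [if_pos hut]
      exact (hc u (F (u :: τ)) t (hF u τ) hut).1
  rw [terminating_iff_isEmpty_path, not_not]
  refine ⟨fun m => (List.range (m + 1)).map fun i => F (Denumerable.ofNat (List ℕ) i),
    fun m => ⟨by simp, ?_, F (Denumerable.ofNat (List ℕ) (m + 1)), by
      dsimp only
      rw [List.range_succ (n := m + 1), List.map_append, List.map_singleton]⟩⟩
  intro i hi j hj hij
  rw [List.length_map, List.length_range] at hi hj
  have := hedge i j hij
  simpa [List.getD_eq_getElem?_getD, hi, hj] using this

/-- The simulation of `s` in `r` answers the search: from the image of a node it picks a child whose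
image must be an `s`-successor. Thus the search traces a path of `s`, waiting finitely long until
the chosen child receives its value. -/
theorem attempt_simLE_delay {r s : ℕ → ℕ → Prop} (h : SimLE s r) :
    SimLE (attempt r s) (delay s) := by
  let Q : List ℕ → ℕ × ℕ → Prop := fun l p =>
    l ≠ [] ∧ ∃ i j t, i < l.length ∧ l.getD i 0 = p.1 ∧ PathEdge r i j ∧
      (Denumerable.ofNat (List ℕ) j).head? = some t ∧ Sim s r p.1 t ∧ j < l.length + p.2
  have hQ : ∀ l p, Q l p → ∀ l', attempt r s l l' → ∃ p', delay s p p' ∧ Q l' p' := by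
    rintro l ⟨b, m⟩ ⟨hl, i, j, t, hi, hib, hij, hjt, hs, hj⟩ _ ⟨-, hhom, v, rfl⟩
    have hget : ∀ i < l.length, (l ++ [v]).getD i 0 = l.getD i 0 := fun i hi => by
      simp [List.getD_eq_getElem?_getD, List.getElem?_append_left hi]
    cases m with
    | succ m =>
      refine ⟨(b, m), Or.inl ⟨rfl, Nat.lt_succ_self m⟩, by simp, i, j, t, ?_, ?_, hij, hjt, hs, ?_⟩
      · rw [List.length_append]; omega
      · rw [hget i hi]; exact hib
      · simp only [List.length_append, List.length_singleton] at hj ⊢; omega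
    | zero =>
      simp only [add_zero] at hj
      have hstep := hhom i (by rw [List.length_append]; omega) j
        (by rw [List.length_append]; omega) hij
      rw [hget i hi, hget j hj, hib] at hstep
      obtain ⟨t', ht', hs'⟩ := hs.step hstep
      -- The countdown restarts at the code of the next child, which is long enough because the list
      -- is nonempty.
      refine ⟨(l.getD j 0, Encodable.encode (t' :: Denumerable.ofNat (List ℕ) j)), Or.inr hstep,
        by simp, j, Encodable.encode (t' :: Denumerable.ofNat (List ℕ) j), t', ?_, hget j hj,
        ⟨t', Denumerable.ofNat_encode _, ?_⟩, ?_, hs', ?_⟩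
      · rw [List.length_append]; omega
      · rw [hjt]
        rintro u ⟨⟩
        exact ht'
      · rw [Denumerable.ofNat_encode]; rfl
      · simp
  intro l
  rcases eq_or_ne l [] with rfl | hl
  · exact ⟨(0, 0), Sim.of_step fun l' hl' => absurd rfl hl'.1⟩
  · obtain ⟨t, ht⟩ := h (l.getD 0 0)
    have h0 : Denumerable.ofNat (List ℕ) 0 = [] := Denumerable.ofNat_encode ([] : List ℕ)
    refine ⟨(l.getD 0 0, Encodable.encode [t]), Q, ⟨hl, 0, Encodable.encode [t], t,
      List.length_pos_iff.2 hl, rfl, ⟨t, ?_, ?_⟩, ?_, ht, ?_⟩, hQ⟩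
    · rw [Denumerable.ofNat_encode, h0]
    · rw [h0]
      rintro u ⟨⟩
    · rw [Denumerable.ofNat_encode]; rfl
    · have := List.length_pos_iff.2 hl
      dsimp only
      omega

/-! ### Kleene–Brouwer codes of systems -/

/-- The lexicographic order on finite sequences in which proper extensions precede their initial
segments (the Kleene–Brouwer order). -/
def KB : List ℕ → List ℕ → Prop
  | [], _ => False
  | _ :: _, [] => True
  | a :: s, b :: t => a < b ∨ (a = b ∧ KB s t)

theorem KB.trichotomous : ∀ s t, ¬ KB s t → ¬ KB t s → s = t
  | [], [], _, _ => rfl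
  | [], _ :: _, _, h => absurd trivial h
  | _ :: _, [], h, _ => absurd trivial h
  | a :: s, b :: t, h, h' => by
    simp only [KB, not_or, not_and, not_lt] at h h'
    have hab : a = b := le_antisymm h'.1 h.1
    rw [hab, trichotomous s t (h.2 hab) (h'.2 hab.symm)]

/-- The tree of paths of `r` that start in a state satisfying `P`; every entry of a node codes a
state together with a dummy natural number. -/
def PathTree (r : ℕ → ℕ → Prop) : (ℕ → Prop) → List ℕ → Prop
  | _, [] => True
  | P, c :: s => P c.unpair.1 ∧ PathTree r (r c.unpair.1) s

/-- The Kleene–Brouwer order restricted to a tree of paths. -/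
def TreeKB (r : ℕ → ℕ → Prop) (P : ℕ → Prop) (s t : List ℕ) : Prop :=
  PathTree r P s ∧ PathTree r P t ∧ KB s t

/-- Nonempty nodes are compared by their first entry, a natural number, and then by tails in a tree
that is well-founded by hypothesis; the empty node is on top. -/
theorem TreeKB.wf_of_step {r : ℕ → ℕ → Prop} {P : ℕ → Prop}
    (h : ∀ b, P b → WellFounded (TreeKB r (r b))) : WellFounded (TreeKB r P) := by
  have hcons : ∀ c s, P c.unpair.1 → Acc (TreeKB r P) (c :: s) := by
    intro c
    induction c using Nat.strong_induction_on with
    | _ c ihc =>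
      intro s hc
      induction s using (h _ hc).induction with
      | _ s ihs =>
        refine Acc.intro _ ?_
        rintro (_ | ⟨d, u⟩) ⟨hu, hs, hk⟩
        · exact hk.elim
        · rcases hk with hk | ⟨rfl, hk⟩
          · exact ihc d hk u hu.1
          · exact ihs u ⟨hu.2, hs.2, hk⟩
  refine ⟨fun s => Acc.intro _ ?_⟩
  rintro (_ | ⟨d, u⟩) ⟨hu, -, hk⟩
  · exact hk.elim
  · exact hcons d u hu.1

theorem Terminating.treeKB_wf {r : ℕ → ℕ → Prop} (h : Terminating r) (P : ℕ → Prop) :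
    WellFounded (TreeKB r P) := by
  have key : ∀ b, WellFounded (TreeKB r (r b)) := fun b => by
    induction b using h.induction with
    | _ b ih => exact TreeKB.wf_of_step ih
  exact TreeKB.wf_of_step fun b _ => key b

/-- The linear order on finite sequences in which the nodes of the tree of paths of `r`, in
Kleene–Brouwer order, come after all the other sequences, in order of their codes. -/
def treeOrder (r : ℕ → ℕ → Prop) (s t : List ℕ) : Prop :=
  (¬ PathTree r (fun _ => True) s ∧
    (PathTree r (fun _ => True) t ∨ Encodable.encode s < Encodable.encode t)) ∨
  TreeKB r (fun _ => True) s t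

theorem treeOrder_trichotomous (r : ℕ → ℕ → Prop) (s t : List ℕ) (h : ¬ treeOrder r s t)
    (h' : ¬ treeOrder r t s) : s = t := by
  unfold treeOrder TreeKB at h h'
  by_cases hs : PathTree r (fun _ => True) s <;> by_cases ht : PathTree r (fun _ => True) t <;>
    simp only [hs, ht, not_true, not_false_iff, true_and, false_and, true_or, or_false,
      false_or, not_lt] at h h'
  · exact KB.trichotomous s t h h'
  · exact Encodable.encode_injective (le_antisymm h' h)

theorem Terminating.treeOrder_wf {r : ℕ → ℕ → Prop} (h : Terminating r) :
    WellFounded (treeOrder r) := by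
  classical
  let f : List ℕ → ℕ ⊕ List ℕ := fun s =>
    if PathTree r (fun _ => True) s then Sum.inr s else Sum.inl (Encodable.encode s)
  refine Subrelation.wf (r := InvImage (Sum.Lex (· < ·) (TreeKB r fun _ => True)) f) ?_
    (InvImage.wf f (Sum.lex_wf wellFounded_lt (h.treeKB_wf _)))
  rintro s t (⟨hs, ht⟩ | ⟨hs, ht, hk⟩)
  · by_cases ht' : PathTree r (fun _ => True) t
    · simp [InvImage, f, hs, ht']
    · simpa [InvImage, f, hs, ht'] using ht
  · simpa [InvImage, f, hs, ht] using ⟨hs, ht, hk⟩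

theorem not_wellFounded_treeOrder {r : ℕ → ℕ → Prop} (h : ¬ Terminating r) :
    ¬ WellFounded (treeOrder r) := by
  rw [terminating_iff_isEmpty_path, not_not] at h
  obtain ⟨f, hf⟩ := h
  rw [wellFounded_iff_isEmpty_descending_chain]
  rintro ⟨hE⟩
  have htree : ∀ n m (P : ℕ → Prop), P (f m) →
      PathTree r P ((List.range n).map fun i => Nat.pair (f (m + i)) 0) := by
    intro n
    induction n with
    | zero => intros; trivial
    | succ n ih =>
      intro m P hP
      rw [List.range_succ_eq_map]
      refine ⟨by simpa using hP, ?_⟩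
      have := ih (m + 1) (r (f m)) (hf m)
      simpa [Function.comp_def, add_assoc, add_comm 1] using this
  have hKB : ∀ (l : List ℕ) a, KB (l ++ [a]) l := by
    intro l a
    induction l with
    | nil => trivial
    | cons b l ih => exact Or.inr ⟨rfl, ih⟩
  refine hE ⟨fun n => (List.range n).map fun i => Nat.pair (f (0 + i)) 0, fun n =>
    Or.inr ⟨htree _ _ _ trivial, htree _ _ _ trivial, ?_⟩⟩
  dsimp only
  rw [List.range_succ, List.map_append]
  exact hKB _ _

/-- `g` selects, for the entries starting in `P`, simulating entries starting in `P'`. -/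
def IsSelector (r r' : ℕ → ℕ → Prop) (P P' : ℕ → Prop) (g : ℕ → ℕ) : Prop :=
  StrictMono g ∧ ∀ c, P c.unpair.1 → P' (g c).unpair.1 ∧ Sim r r' c.unpair.1 (g c).unpair.1

/-- The dummy component gives each state arbitrarily large codes, so the simulating entries can be
chosen strictly increasing. This makes `treeMap` preserve the Kleene–Brouwer order. -/
theorem exists_isSelector {r r' : ℕ → ℕ → Prop} {P P' : ℕ → Prop}
    (h : ∀ a, P a → ∃ a', P' a' ∧ Sim r r' a a') : ∃ g, IsSelector r r' P P' g := by
  refine Filter.extraction_forall_of_frequently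
    (P := fun c v => P c.unpair.1 → P' v.unpair.1 ∧ Sim r r' c.unpair.1 v.unpair.1) fun c => ?_
  rw [Filter.frequently_atTop]
  intro N
  by_cases hc : P c.unpair.1
  · obtain ⟨a', ha', hs⟩ := h _ hc
    exact ⟨Nat.pair a' N, Nat.right_le_pair a' N, fun _ => by simpa using ⟨ha', hs⟩⟩
  · exact ⟨N, le_rfl, fun h => absurd h hc⟩

/-- A selector for the given sets of states (any function if there is none). -/
noncomputable def selector (r r' : ℕ → ℕ → Prop) (P P' : ℕ → Prop) : ℕ → ℕ :=
  Classical.epsilon (IsSelector r r' P P')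

/-- The map between trees of paths obtained by applying selectors entry by entry. -/
noncomputable def treeMap (r r' : ℕ → ℕ → Prop) : (ℕ → Prop) → (ℕ → Prop) → List ℕ → List ℕ
  | _, _, [] => []
  | P, P', c :: s => selector r r' P P' c ::
      treeMap r r' (r c.unpair.1) (r' (selector r r' P P' c).unpair.1) s

theorem treeMap_mem {r r' : ℕ → ℕ → Prop} {P P' : ℕ → Prop}
    (h : ∀ a, P a → ∃ a', P' a' ∧ Sim r r' a a') {s : List ℕ} (hs : PathTree r P s) :
    PathTree r' P' (treeMap r r' P P' s) := by
  induction s generalizing P P' with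
  | nil => trivial
  | cons c s ih =>
    have hg : IsSelector r r' P P' (selector r r' P P') :=
      Classical.epsilon_spec (exists_isSelector h)
    exact ⟨(hg.2 c hs.1).1, ih (fun a ha => (hg.2 c hs.1).2.step ha) hs.2⟩

theorem treeMap_kb {r r' : ℕ → ℕ → Prop} {P P' : ℕ → Prop}
    (h : ∀ a, P a → ∃ a', P' a' ∧ Sim r r' a a') {s t : List ℕ} (hs : PathTree r P s)
    (ht : PathTree r P t) (hk : KB s t) : KB (treeMap r r' P P' s) (treeMap r r' P P' t) := by
  induction s generalizing P P' t with
  | nil => exact hk.elim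
  | cons c s ih =>
    cases t with
    | nil => trivial
    | cons d t =>
      have hg : IsSelector r r' P P' (selector r r' P P') :=
        Classical.epsilon_spec (exists_isSelector h)
      rcases hk with hk | ⟨rfl, hk⟩
      · exact Or.inl (hg.1 hk)
      · exact Or.inr ⟨rfl, ih (fun a ha => (hg.2 c hs.1).2.step ha) hs.2 ht.2 hk⟩

/-- Leaves room for all non-nodes of another tree, mapped increasingly in `exists_treeOrder_map`. A
terminating system has no loop at 0, so the path 0, 0 is never genuine, whatever the dummy. -/
theorem Terminating.infinite_not_pathTree {r : ℕ → ℕ → Prop} (h : Terminating r) :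
    {n | ¬ PathTree r (fun _ => True) (Denumerable.ofNat (List ℕ) n)}.Infinite := by
  have hirr : ¬ r 0 0 := fun h0 => (h.irrefl.irrefl 0) h0
  refine Set.infinite_of_injective_forall_mem
    (f := fun m => Encodable.encode [Nat.pair 0 0, Nat.pair 0 m]) ?_ ?_
  · intro m m' hm
    have := Encodable.encode_injective hm
    simpa using this
  · intro m
    rw [Set.mem_ofPred_eq, Denumerable.ofNat_encode]
    simp only [PathTree, Nat.unpair_pair, true_and, and_true]
    exact hirr

theorem exists_treeOrder_map {r r' : ℕ → ℕ → Prop} (h : SimLE r r') (hr' : Terminating r') :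
    ∃ f : List ℕ → List ℕ, ∀ s t, treeOrder r s t → treeOrder r' (f s) (f t) := by
  classical
  have hinf := hr'.infinite_not_pathTree
  have hP : ∀ a, True → ∃ a', True ∧ Sim r r' a a' := fun a _ => by simpa using h a
  let φ : ℕ → ℕ := Nat.nth fun n => ¬ PathTree r' (fun _ => True) (Denumerable.ofNat (List ℕ) n)
  have hφ : ∀ n, ¬ PathTree r' (fun _ => True) (Denumerable.ofNat (List ℕ) (φ n)) :=
    Nat.nth_mem_of_infinite hinf
  have hmono : StrictMono φ := Nat.nth_strictMono hinf
  refine ⟨fun s => if PathTree r (fun _ => True) s then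
    treeMap r r' (fun _ => True) (fun _ => True) s
    else Denumerable.ofNat (List ℕ) (φ (Encodable.encode s)), ?_⟩
  rintro s t (⟨hs, ht⟩ | ⟨hs, ht, hk⟩)
  · by_cases ht' : PathTree r (fun _ => True) t
    · simp only [hs, ht', if_true, if_false]
      exact Or.inl ⟨hφ _, Or.inl (treeMap_mem hP ht')⟩
    · simp only [hs, ht', if_false]
      refine Or.inl ⟨hφ _, Or.inr ?_⟩
      rw [Denumerable.encode_ofNat, Denumerable.encode_ofNat]
      exact hmono (ht.resolve_left ht')
  · simp only [hs, ht, if_true]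
    exact Or.inr ⟨treeMap_mem hP hs, treeMap_mem hP ht, treeMap_kb hP hs ht hk⟩

open Classical in
/-- The code of the order `treeOrder r`, transported to `ℕ`. -/
noncomputable def treeCode (r : ℕ → ℕ → Prop) (p : ℕ × ℕ) : Bool :=
  decide (p.1 = p.2 ∨
    treeOrder r (Denumerable.ofNat (List ℕ) p.1) (Denumerable.ofNat (List ℕ) p.2))

theorem codeLT_treeCode_of_ne (r : ℕ → ℕ → Prop) {a b : ℕ} (h : a ≠ b) :
    codeLT (treeCode r) a b ↔
      treeOrder r (Denumerable.ofNat (List ℕ) a) (Denumerable.ofNat (List ℕ) b) := by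
  simp [codeLT, treeCode, h]

theorem KB.irrefl : ∀ s, ¬ KB s s
  | [], h => h
  | _ :: s, h => h.elim (lt_irrefl _) fun h => KB.irrefl s h.2

theorem treeOrder_irrefl (r : ℕ → ℕ → Prop) (s : List ℕ) : ¬ treeOrder r s s := by
  rintro (⟨h, h' | h'⟩ | ⟨-, -, h⟩)
  · exact h h'
  · exact lt_irrefl _ h'
  · exact KB.irrefl s h

theorem codeLT_treeCode (r : ℕ → ℕ → Prop) (a b : ℕ) :
    codeLT (treeCode r) a b ↔
      treeOrder r (Denumerable.ofNat (List ℕ) a) (Denumerable.ofNat (List ℕ) b) := by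
  rcases eq_or_ne a b with rfl | h
  · exact iff_of_false (fun h => h.2 rfl) (treeOrder_irrefl r _)
  · exact codeLT_treeCode_of_ne r h

theorem treeCode_mem_WO {r : ℕ → ℕ → Prop} : treeCode r ∈ WO ↔ Terminating r := by
  constructor
  · rintro ⟨-, hwo⟩
    by_contra hr
    refine not_wellFounded_treeOrder hr
      (Subrelation.wf ?_ (InvImage.wf (Encodable.encode : List ℕ → ℕ) hwo.wf))
    intro s t hst
    change codeLT _ _ _
    rwa [codeLT_treeCode, Denumerable.ofNat_encode, Denumerable.ofNat_encode]
  · intro hr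
    refine ⟨fun a => by simp [treeCode], ?_⟩
    refine @IsWellOrder.mk _ _ ⟨Subrelation.wf (fun h => (codeLT_treeCode r _ _).1 h)
      (InvImage.wf (Denumerable.ofNat (List ℕ)) hr.treeOrder_wf)⟩ ⟨fun a b h h' => ?_⟩
    rw [codeLT_treeCode] at h h'
    have := congrArg Encodable.encode (treeOrder_trichotomous r _ _ h h')
    simpa using this

theorem otype_treeCode_le {r r' : ℕ → ℕ → Prop} (h : SimLE r r') (hr : treeCode r ∈ WO)
    (hr' : treeCode r' ∈ WO) : WO.otype ⟨_, hr⟩ ≤ WO.otype ⟨_, hr'⟩ := by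
  obtain ⟨f, hf⟩ := exists_treeOrder_map h (treeCode_mem_WO.1 hr')
  have := hr.2
  have := hr'.2
  refine Ordinal.type_le_iff'.2 ⟨RelEmbedding.ofMonotone
    (fun n => Encodable.encode (f (Denumerable.ofNat (List ℕ) n))) fun a b hab => ?_⟩
  rw [codeLT_treeCode] at hab ⊢
  simpa using hf _ _ hab

/-! ### Sums and guarded systems -/

/-- The system on `ℕ` corresponding to a system on a denumerable type. -/
def onNat {σ : Type*} [Denumerable σ] (r : σ → σ → Prop) (m n : ℕ) : Prop :=
  r (Denumerable.ofNat σ m) (Denumerable.ofNat σ n)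

theorem onNat_simLE {σ : Type*} [Denumerable σ] (r : σ → σ → Prop) : SimLE (onNat r) r :=
  SimLE.of_map (Denumerable.ofNat σ) fun _ _ h => h

theorem simLE_onNat {σ : Type*} [Denumerable σ] (r : σ → σ → Prop) : SimLE r (onNat r) :=
  SimLE.of_map Encodable.encode fun _ _ h => by
    rwa [onNat, Denumerable.ofNat_encode, Denumerable.ofNat_encode]

/-- The disjoint sum of the systems `W 0, …, W n`. -/
def initialSum (W : ℕ → ℕ → ℕ → Prop) (n x y : ℕ) : Prop :=
  x.unpair.1 = y.unpair.1 ∧ x.unpair.1 ≤ n ∧ W x.unpair.1 x.unpair.2 y.unpair.2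

theorem simLE_initialSum (W : ℕ → ℕ → ℕ → Prop) {m n : ℕ} (h : m ≤ n) :
    SimLE (W m) (initialSum W n) :=
  SimLE.of_map (Nat.pair m) fun a b hab => by simpa [initialSum] using ⟨h, hab⟩

theorem initialSum_simLE {W : ℕ → ℕ → ℕ → Prop} {n : ℕ} {s : ℕ → ℕ → Prop}
    (h : ∀ m ≤ n, SimLE (W m) s) : SimLE (initialSum W n) s := by
  intro x
  by_cases hx : x.unpair.1 ≤ n
  · obtain ⟨b, hb⟩ := h _ hx x.unpair.2
    refine ⟨b, fun z y => z.unpair.1 = x.unpair.1 ∧ Sim (W x.unpair.1) s z.unpair.2 y,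
      ⟨rfl, hb⟩, ?_⟩
    rintro z y ⟨hz, hs⟩ z' ⟨h1, -, h2⟩
    rw [hz] at h2
    obtain ⟨y', hy, hs'⟩ := hs.step h2
    exact ⟨y', hy, h1.symm.trans hz, hs'⟩
  · exact ⟨0, Sim.of_step fun a' ha => absurd ha.2.1 hx⟩

theorem terminating_initialSum {W : ℕ → ℕ → ℕ → Prop} {n : ℕ} :
    Terminating (initialSum W n) ↔ ∀ m ≤ n, Terminating (W m) := by
  refine ⟨fun h m hm => (simLE_initialSum W hm).terminating h, fun h => ?_⟩
  rw [terminating_iff_isEmpty_path]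
  rintro ⟨f, hf⟩
  have hc : ∀ i, (f i).unpair.1 = (f 0).unpair.1 := fun i => by
    induction i with
    | zero => rfl
    | succ i ih => rw [← (hf i).1, ih]
  refine terminating_iff_isEmpty_path.1 (h _ (hf 0).2.1) ⟨fun i => (f i).unpair.2, fun i => ?_⟩
  have := (hf i).2.2
  rwa [hc i] at this

/-- The system that runs a delayed copy of `V` next to the attempts to embed one of the systems
`U k`, for `k` satisfying `K`, strictly below a state of `V`. -/
def guarded (V : ℕ → ℕ → Prop) (U : ℕ → ℕ → ℕ → Prop) (K : ℕ → Prop) :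
    (ℕ × ℕ) ⊕ (ℕ × List ℕ) → (ℕ × ℕ) ⊕ (ℕ × List ℕ) → Prop
  | Sum.inl a, Sum.inl b => delay V a b
  | Sum.inr a, Sum.inr b => a.1 = b.1 ∧ K a.1 ∧ attempt (U a.1) V a.2 b.2
  | _, _ => False

section Guarded

variable {V : ℕ → ℕ → Prop} {U : ℕ → ℕ → ℕ → Prop} {K : ℕ → Prop}

theorem delay_simLE_guarded : SimLE (delay V) (guarded V U K) :=
  SimLE.of_map Sum.inl fun _ _ h => h

theorem attempt_simLE_guarded {k : ℕ} (hk : K k) : SimLE (attempt (U k) V) (guarded V U K) :=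
  SimLE.of_map (fun l => Sum.inr (k, l)) fun _ _ h => ⟨rfl, hk, h⟩

theorem guarded_simLE_delay (h : ∀ k, K k → SimLE V (U k)) :
    SimLE (guarded V U K) (delay V) := by
  rintro (a | ⟨k, l⟩)
  · refine ⟨a, fun x y => x = Sum.inl y, rfl, ?_⟩
    rintro _ y rfl (y' | _) hy
    · exact ⟨y', hy, rfl⟩
    · exact hy.elim
  · by_cases hk : K k
    · obtain ⟨b, hb⟩ := attempt_simLE_delay (h k hk) l
      refine ⟨b, fun x y => ∃ l, x = Sum.inr (k, l) ∧ Sim (attempt (U k) V) (delay V) l y,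
        ⟨l, rfl, hb⟩, ?_⟩
      rintro _ y ⟨l, rfl, hs⟩ (_ | ⟨k', l'⟩) hx
      · exact hx.elim
      · obtain ⟨rfl, -, hx⟩ := hx
        obtain ⟨y', hy, hs'⟩ := hs.step hx
        exact ⟨y', hy, l', rfl, hs'⟩
    · refine ⟨(0, 0), Sim.of_step ?_⟩
      rintro (_ | _) hx
      · exact hx.elim
      · exact absurd hx.2.1 hk

/-- By comparability, if `V` is not simulated by `U k`, then `U k` is strictly below `V` and the
search runs forever. Otherwise the whole system is bounded by a delayed copy of `V`. -/
theorem terminating_guarded :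
    Terminating (guarded V U K) ↔ Terminating V ∧ ∀ k, K k → SimLE V (U k) := by
  constructor
  · intro h
    have hV : Terminating V := ((simLE_delay V).trans delay_simLE_guarded).terminating h
    refine ⟨hV, fun k hk => (hV.simLE_or_strictBelow (U k)).resolve_right fun hs => ?_⟩
    exact attempt_not_terminating hs ((attempt_simLE_guarded hk).terminating h)
  · rintro ⟨hV, h⟩
    exact (guarded_simLE_delay h).terminating hV.delay

end Guarded

/-! ### Continuity and definability -/

section Clopen

variable {X : Type*} [TopologicalSpace X]

theorem isClopen_setOf_const (c : Prop) : IsClopen {_x : X | c} := by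
  by_cases h : c <;> simp [h, isClopen_univ, isClopen_empty]

theorem IsClopen.setOf_and {P Q : X → Prop} (hP : IsClopen {x | P x}) (hQ : IsClopen {x | Q x}) :
    IsClopen {x | P x ∧ Q x} := hP.inter hQ

theorem IsClopen.setOf_or {P Q : X → Prop} (hP : IsClopen {x | P x}) (hQ : IsClopen {x | Q x}) :
    IsClopen {x | P x ∨ Q x} := hP.union hQ

theorem IsClopen.setOf_not {P : X → Prop} (hP : IsClopen {x | P x}) :
    IsClopen {x | ¬ P x} := hP.compl

theorem IsClopen.setOf_imp {P Q : X → Prop} (hP : IsClopen {x | P x}) (hQ : IsClopen {x | Q x}) :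
    IsClopen {x | P x → Q x} := by
  simpa only [imp_iff_not_or] using hP.setOf_not.setOf_or hQ

theorem IsClopen.setOf_forall_lt {P : ℕ → X → Prop} (hP : ∀ i, IsClopen {x | P i x}) (n : ℕ) :
    IsClopen {x | ∀ i < n, P i x} := by
  have := (Set.finite_Iio n).isClopen_biInter (f := fun i => {x | P i x}) fun i _ => hP i
  convert this using 1
  ext x
  simp

variable {r s : X → ℕ → ℕ → Prop}

theorem isClopen_pathTree (hr : ∀ a b, IsClopen {x | r x a b}) {P : X → ℕ → Prop}
    (hP : ∀ a, IsClopen {x | P x a}) (l : List ℕ) : IsClopen {x | PathTree (r x) (P x) l} := by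
  induction l generalizing P with
  | nil => exact isClopen_setOf_const True
  | cons c l ih => exact (hP _).setOf_and (ih fun b => hr _ b)

theorem continuous_treeCode (hr : ∀ a b, IsClopen {x | r x a b}) :
    Continuous fun x => treeCode (r x) := by
  have hT := isClopen_pathTree hr (P := fun _ _ => True) fun _ => isClopen_setOf_const True
  refine continuous_pi fun p => (continuous_bool_rng true).2 ?_
  have : IsClopen {x | p.1 = p.2 ∨
      treeOrder (r x) (Denumerable.ofNat (List ℕ) p.1) (Denumerable.ofNat (List ℕ) p.2)} :=
    (isClopen_setOf_const _).setOf_or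
      (((hT _).setOf_not.setOf_and ((hT _).setOf_or (isClopen_setOf_const _))).setOf_or
        ((hT _).setOf_and ((hT _).setOf_and (isClopen_setOf_const _))))
  convert this using 1
  ext x
  simp [treeCode]

theorem isClopen_pathEdge (hr : ∀ a b, IsClopen {x | r x a b}) (i j : ℕ) :
    IsClopen {x | PathEdge (r x) i j} := by
  by_cases h : ∃ t, Denumerable.ofNat (List ℕ) j = t :: Denumerable.ofNat (List ℕ) i
  · obtain ⟨t, ht⟩ := h
    have hiff : ∀ x, PathEdge (r x) i j ↔
        ∀ u ∈ (Denumerable.ofNat (List ℕ) i).head?, r x u t := by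
      intro x
      refine ⟨?_, fun hx => ⟨t, ht, hx⟩⟩
      rintro ⟨t', ht', hx⟩
      rw [ht] at ht'
      cases (List.cons.inj ht').1
      exact hx
    simp only [hiff]
    cases (Denumerable.ofNat (List ℕ) i).head? with
    | none => simp [isClopen_univ]
    | some u => simpa using hr u t
  · have hiff : ∀ x, ¬ PathEdge (r x) i j := fun x hx => h (hx.imp fun _ => And.left)
    simp [hiff, isClopen_empty]

theorem isClopen_attempt (hr : ∀ a b, IsClopen {x | r x a b})
    (hs : ∀ a b, IsClopen {x | s x a b}) (l l' : List ℕ) :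
    IsClopen {x | attempt (r x) (s x) l l'} :=
  (isClopen_setOf_const _).setOf_and <| .setOf_and
    (.setOf_forall_lt (fun i => .setOf_forall_lt (fun j => .setOf_imp (isClopen_pathEdge hr i j)
      (hs _ _)) _) _) (isClopen_setOf_const _)

theorem isClopen_guarded {U : X → ℕ → ℕ → ℕ → Prop} (K : ℕ → Prop)
    (hU : ∀ k a b, IsClopen {x | U x k a b}) (hs : ∀ a b, IsClopen {x | s x a b}) :
    ∀ a b, IsClopen {x | guarded (s x) (U x) K a b}
  | .inl _, .inl _ => (isClopen_setOf_const _).setOf_or (hs _ _)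
  | .inr _, .inr _ => (isClopen_setOf_const _).setOf_and <| (isClopen_setOf_const _).setOf_and
      (isClopen_attempt (hU _) hs _ _)
  | .inl _, .inr _ => isClopen_setOf_const False
  | .inr _, .inl _ => isClopen_setOf_const False

theorem analyticSet_not_terminating [PolishSpace X] (hr : ∀ a b, IsClopen {x | r x a b}) :
    MeasureTheory.AnalyticSet {x | ¬ Terminating (r x)} := by
  have hcl : IsClosed {q : X × (ℕ → ℕ) | ∀ n, r q.1 (q.2 n) (q.2 (n + 1))} := by
    rw [Set.ofPred_forall]
    refine isClosed_iInter fun n => ⟨?_⟩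
    have : {q : X × (ℕ → ℕ) | r q.1 (q.2 n) (q.2 (n + 1))}ᶜ =
        ⋃ a : ℕ, ⋃ b : ℕ, {x | ¬ r x a b} ×ˢ ({f : ℕ → ℕ | f n = a} ∩ {f | f (n + 1) = b}) := by
      ext q
      simp
    rw [this]
    refine isOpen_iUnion fun a => isOpen_iUnion fun b => (hr a b).compl.isOpen.prod ?_
    have hpre : ∀ m c, IsOpen {f : ℕ → ℕ | f m = c} := fun m c =>
      (continuous_apply (A := fun _ => ℕ) m).isOpen_preimage {c} (isOpen_discrete _)
    exact (hpre n a).inter (hpre (n + 1) b)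
  convert hcl.analyticSet.image_of_continuous continuous_fst using 1
  ext x
  simp [terminating_iff_isEmpty_path]

end Clopen

theorem reducesToWO_treeCode {r : Baire → ℕ → ℕ → Prop} (hr : ∀ a b, IsClopen {x | r x a b}) :
    ReducesToWO (fun x => treeCode (r x)) {x | Terminating (r x)} :=
  ⟨continuous_treeCode hr, fun _ => treeCode_mem_WO.symm⟩

theorem isPi11_terminating {r : Baire → ℕ → ℕ → Prop} (hr : ∀ a b, IsClopen {x | r x a b}) :
    IsPi11 {x | Terminating (r x)} :=
  analyticSet_not_terminating hr

/-! ### The universal matrix -/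

/-- The first `m` values of `x`. -/
def firstValues (x : Baire) (m : ℕ) : List ℕ := List.ofFn fun i : Fin m => x i

theorem continuous_firstValues {Y : Type*} [TopologicalSpace Y] (m : ℕ) (g : List ℕ → Y) :
    Continuous fun x => g (firstValues x m) := by
  have h : Continuous fun x : Baire => fun i : Fin m => x i :=
    continuous_pi fun i => continuous_apply _
  exact (continuous_of_discreteTopology (f := fun v : Fin m → ℕ => g (List.ofFn v))).comp h

theorem IsOpen.exists_firstValues {s : Set Baire} (hs : IsOpen s) {x : Baire} (hx : x ∈ s) :
    ∃ m, ∀ y, firstValues y m = firstValues x m → y ∈ s := by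
  obtain ⟨_, ⟨z, m, rfl⟩, hxm, hsub⟩ :=
    (PiNat.isTopologicalBasis_cylinders (fun _ => ℕ)).isOpen_iff.1 hs x hx
  refine ⟨m, fun y hy => hsub fun i hi => ?_⟩
  exact (congrFun (List.ofFn_injective hy) ⟨i, hi⟩).trans (hxm i hi)

/-- The systems decoded from `p`: a step to a state with second component `m` consults `p` at an
argument that depends on the first `m` values of `p` itself. -/
def decoded (p : Baire) (j n s t : ℕ) : Prop :=
  p (Encodable.encode (j, n, s.unpair.1, t.unpair.1, firstValues p t.unpair.2)) = 1

theorem isClopen_decoded (j n s t : ℕ) : IsClopen {p | decoded p j n s t} := by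
  have hc : Continuous fun p : Baire =>
      p (Encodable.encode (j, n, s.unpair.1, t.unpair.1, firstValues p t.unpair.2)) := by
    have hg := continuous_firstValues t.unpair.2
      fun l => Encodable.encode (j, n, s.unpair.1, t.unpair.1, l)
    refine continuous_iff_continuousAt.2 fun p => ?_
    have hev := (hg.continuousAt (x := p)).eventually (IsOpen.mem_nhds
      (isOpen_discrete {Encodable.encode (j, n, s.unpair.1, t.unpair.1,
        firstValues p t.unpair.2)}) rfl)
    refine ((continuous_apply (Encodable.encode (j, n, s.unpair.1, t.unpair.1,
      firstValues p t.unpair.2))).continuousAt (x := p)).congr ?_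
    filter_upwards [hev] with q hq
    rw [Set.mem_singleton_iff.1 hq]
  exact (isClopen_discrete {1}).preimage hc

/-- The system that is used to decide membership of `p` in entry `(j, n)` of the universal matrix
with `ℓ` rows. -/
def entrySystem (ℓ j n : ℕ) (p : Baire) : ℕ → ℕ → Prop :=
  onNat (guarded (initialSum (decoded p j) n) (fun k => initialSum (decoded p k) 0)
    fun k => j < k ∧ k < ℓ)

/-- A matrix that agrees, at a suitable point, with any given `ω`-change matrix. -/
def universalMatrix (ℓ : ℕ) (j : Fin ℓ) (n : ℕ) : Set Baire :=
  {p | Terminating (entrySystem ℓ j n p)}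

/-- Summing over all columns up to n makes both conditions range over m ≤ n, hence the rows
decrease. -/
theorem mem_universalMatrix {ℓ : ℕ} {j : Fin ℓ} {n : ℕ} {p : Baire} :
    p ∈ universalMatrix ℓ j n ↔ (∀ m ≤ n, Terminating (decoded p j m)) ∧
      ∀ k : Fin ℓ, j < k → ∀ m ≤ n, SimLE (decoded p j m) (decoded p k 0) := by
  have h1 : p ∈ universalMatrix ℓ j n ↔ Terminating (guarded (initialSum (decoded p j) n)
      (fun k => initialSum (decoded p k) 0) fun k => j < k ∧ k < ℓ) :=
    ⟨(simLE_onNat _).terminating, (onNat_simLE _).terminating⟩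
  rw [h1, terminating_guarded, terminating_initialSum]
  refine and_congr_right fun _ => ⟨fun h k hk m hm => ?_, fun h k hk => ?_⟩
  · refine ((simLE_initialSum _ hm).trans (h k ⟨hk, k.2⟩)).trans (initialSum_simLE ?_)
    rintro m hm
    rw [Nat.le_zero.1 hm]
    exact SimLE.of_map id fun _ _ h => h
  · exact initialSum_simLE fun m hm =>
      (h ⟨k, hk.2⟩ hk.1 m hm).trans (simLE_initialSum (decoded p k) le_rfl)

theorem isClopen_entrySystem (ℓ j n a b : ℕ) : IsClopen {p | entrySystem ℓ j n p a b} := by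
  have hV : ∀ j n a b, IsClopen {p | initialSum (decoded p j) n a b} := fun j n a b =>
    (isClopen_setOf_const _).setOf_and ((isClopen_setOf_const _).setOf_and (isClopen_decoded ..))
  exact isClopen_guarded (fun k => j < k ∧ k < ℓ) (fun k a b => hV k 0 a b) (hV j n)
    (Denumerable.ofNat _ a) (Denumerable.ofNat _ b)

/-- This gives condition (2). The entry in row j is bounded by a delayed copy of its decoded system,
hence by a delayed copy of the row-k system, which is part of the entry (k, 0) by construction. -/
theorem entrySystem_simLE {ℓ n : ℕ} {j k : Fin ℓ} (hjk : j < k) {p : Baire}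
    (h : p ∈ universalMatrix ℓ j n) : SimLE (entrySystem ℓ j n p) (entrySystem ℓ k 0 p) := by
  have hg := terminating_guarded.1 ((simLE_onNat _).terminating h)
  exact (onNat_simLE _).trans <| (guarded_simLE_delay hg.2).trans <|
    (hg.2 k ⟨hjk, k.2⟩).delay.trans <| delay_simLE_guarded.trans (simLE_onNat _)

theorem isOmegaChangeMatrix_universalMatrix (ℓ : ℕ) :
    IsOmegaChangeMatrix (universalMatrix ℓ) := by
  refine ⟨fun j n => isPi11_terminating (isClopen_entrySystem ℓ j n), fun j => ?_,
    fun j n p => treeCode (entrySystem ℓ j n p),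
    fun j n => reducesToWO_treeCode (isClopen_entrySystem ℓ j n), ?_⟩
  · intro n n' hn p hp
    rw [mem_universalMatrix] at hp ⊢
    exact ⟨fun m hm => hp.1 m (hm.trans hn), fun k hk m hm => hp.2 k hk m (hm.trans hn)⟩
  · rintro j k hjk α n p ⟨⟨hk, hα⟩, hj⟩
    exact ⟨treeCode_mem_WO.2 hj,
      (otype_treeCode_le (entrySystem_simLE hjk hj) (treeCode_mem_WO.2 hj) hk).trans_lt hα⟩

/-! ### The diagonal point -/

/-- The system of descending paths through the order coded by `y`; it has loops if `y` fails to
be reflexive and total. -/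
def descent (y : ℕ × ℕ → Bool) (a b : ℕ) : Prop :=
  codeLT y b a ∨ (a = b ∧ ∃ i < a, ∃ j < a, y (i, j) = false ∧ (y (j, i) = false))

theorem terminating_descent {y : ℕ × ℕ → Bool} : Terminating (descent y) ↔ y ∈ WO := by
  constructor
  · intro h
    have htot : ∀ i j, y (i, j) = false → y (j, i) = false → False := by
      intro i j hij hji
      -- The state i + j + 1 exceeds both indices, so it carries the loop caused by their
      -- incomparability.
      refine h.irrefl.irrefl (i + j + 1) (Or.inr ⟨rfl, i, by omega, j, by omega, hij, hji⟩)
    refine ⟨fun a => ?_, @IsWellOrder.mk _ _ ⟨Subrelation.wf (fun h => Or.inl h) h⟩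
      ⟨fun a b hab hba => ?_⟩⟩
    · by_contra ha
      rw [Bool.not_eq_true] at ha
      exact htot a a ha ha
    · by_contra hne
      refine htot a b ?_ ?_
      · simpa [codeLT, hne] using hab
      · simpa [codeLT, Ne.symm hne] using hba
  · rintro ⟨hrefl, hwo⟩
    refine Subrelation.wf ?_ hwo.wf
    rintro b a (h | ⟨-, i, -, j, -, hij, hji⟩)
    · exact h
    · exfalso
      have hne : i ≠ j := fun h => by
        rw [h, hrefl] at hij
        cases hij
      refine hne (hwo.trichotomous i j ?_ ?_) <;> simp [codeLT, hij, hji]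

theorem descent_of_mem_WO {y : ℕ × ℕ → Bool} (hy : y ∈ WO) {a b : ℕ} (h : descent y a b) :
    codeLT y b a := by
  rcases h with h | ⟨rfl, h⟩
  · exact h
  · exact absurd (Or.inr ⟨rfl, h⟩) ((terminating_descent.2 hy).irrefl.irrefl a)

theorem descent_simLE {y z : ℕ × ℕ → Bool} (hy : y ∈ WO) (hz : z ∈ WO)
    (h : WO.otype ⟨y, hy⟩ ≤ WO.otype ⟨z, hz⟩) : SimLE (descent y) (descent z) := by
  have := hy.2
  have := hz.2
  obtain ⟨f⟩ := Ordinal.type_le_iff'.1 h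
  exact SimLE.of_map f fun a b hab => Or.inl (f.map_rel_iff.2 (descent_of_mem_WO hy hab))

theorem isClopen_descent {X : Type*} [TopologicalSpace X] {o : X → ℕ × ℕ → Bool}
    (ho : Continuous o) (a b : ℕ) : IsClopen {x | descent (o x) a b} := by
  have h : ∀ q c, IsClopen {x | o x q = c} := fun q c =>
    (isClopen_discrete {c}).preimage ((continuous_apply q).comp ho)
  have hex : ∀ (P : ℕ → X → Prop), (∀ i, IsClopen {x | P i x}) → ∀ n,
      IsClopen {x | ∃ i < n, P i x} := fun P hP n => by
    simpa using (IsClopen.setOf_forall_lt (fun i => (hP i).setOf_not) n).setOf_not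
  exact .setOf_or ((h _ _).setOf_and (isClopen_setOf_const _)) <| .setOf_and
    (isClopen_setOf_const _) <| hex _ (fun i => hex _ (fun j => (h _ _).setOf_and (h _ _)) _) _

/-- No circularity arises: p records which finite sequences σ force a step for every x extending σ.
A step that holds at p itself is forced by an initial segment of p, as the relations are open, and
`decoded` consults p at its own initial segments. -/
theorem exists_code {ρ : ℕ → ℕ → Baire → ℕ → ℕ → Prop}
    (hρ : ∀ j n a b, IsClopen {x | ρ j n x a b}) :
    ∃ p : Baire, ∀ j n, SimLE (decoded p j n) (ρ j n p) ∧ SimLE (ρ j n p) (decoded p j n) := by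
  classical
  let C : ℕ × ℕ × ℕ × ℕ × List ℕ → Prop := fun q =>
    ∀ x, firstValues x q.2.2.2.2.length = q.2.2.2.2 → ρ q.1 q.2.1 x q.2.2.1 q.2.2.2.1
  let p : Baire := fun i => if C (Denumerable.ofNat _ i) then 1 else 0
  have hp : ∀ j n s t, decoded p j n s t ↔
      ∀ x, firstValues x t.unpair.2 = firstValues p t.unpair.2 →
        ρ j n x s.unpair.1 t.unpair.1 := by
    intro j n s t
    have hlen : (firstValues p t.unpair.2).length = t.unpair.2 := List.length_ofFn
    have : decoded p j n s t ↔
        C (j, n, s.unpair.1, t.unpair.1, firstValues p t.unpair.2) := by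
      rw [decoded]
      change (if C (Denumerable.ofNat _ (Encodable.encode
        (j, n, s.unpair.1, t.unpair.1, firstValues p t.unpair.2))) then 1 else 0) = 1 ↔ _
      rw [Denumerable.ofNat_encode]
      simp
    rw [this]
    simp only [C, hlen]
  refine ⟨p, fun j n => ⟨SimLE.of_map (fun s => s.unpair.1) fun s t h => (hp j n s t).1 h p rfl,
    fun a => ⟨Nat.pair a 0, fun x y => y.unpair.1 = x, by simp, ?_⟩⟩⟩
  rintro _ y rfl b hb
  obtain ⟨m, hm⟩ := (hρ j n y.unpair.1 b).isOpen.exists_firstValues hb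
  refine ⟨Nat.pair b m, (hp j n _ _).2 ?_, by simp⟩
  simpa using hm

theorem exists_mem_universalMatrix_iff {ℓ : ℕ} {B : Fin ℓ → ℕ → Set Baire}
    (hB : IsOmegaChangeMatrix B) : ∃ p, ∀ (j : Fin ℓ) n, p ∈ universalMatrix ℓ j n ↔ p ∈ B j n := by
  obtain ⟨-, hanti, o, hred, hch⟩ := hB
  let ρ : ℕ → ℕ → Baire → ℕ → ℕ → Prop := fun j n x a b =>
    ∃ h : j < ℓ, descent (o ⟨j, h⟩ n x) a b
  have hρ : ∀ j n a b, IsClopen {x | ρ j n x a b} := by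
    intro j n a b
    by_cases h : j < ℓ
    · simpa [ρ, h] using isClopen_descent (hred ⟨j, h⟩ n).1 a b
    · simp [ρ, h, isClopen_empty]
  obtain ⟨p, hp⟩ := exists_code hρ
  have h1 : ∀ (j : Fin ℓ) n, SimLE (decoded p j n) (descent (o j n p)) := fun j n =>
    (hp j n).1.trans (SimLE.of_map id fun _ _ h => h.2)
  have h2 : ∀ (j : Fin ℓ) n, SimLE (descent (o j n p)) (decoded p j n) := fun j n =>
    SimLE.trans (SimLE.of_map id fun _ _ h => ⟨j.2, h⟩) (hp j n).2
  have hmem : ∀ (j : Fin ℓ) n, Terminating (decoded p j n) ↔ p ∈ B j n := by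
    intro j n
    rw [(hred j n).2, ← terminating_descent]
    exact ⟨(h2 j n).terminating, (h1 j n).terminating⟩
  refine ⟨p, fun j n => ?_⟩
  rw [mem_universalMatrix]
  refine ⟨fun h => (hmem j n).1 (h.1 n le_rfl), fun h => ?_⟩
  have hm : ∀ m ≤ n, p ∈ B j m := fun m hmn => hanti j hmn h
  refine ⟨fun m hmn => (hmem j m).2 (hm m hmn), fun k hjk m hmn => ?_⟩
  have hT := (hmem j m).2 (hm m hmn)
  refine (hT.simLE_or_strictBelow (decoded p k 0)).resolve_right fun hs => ?_
  have hk : p ∈ B k 0 := (hmem k 0).1 (hs.simLE.terminating hT)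
  refine hT.not_strictBelow (((h1 j m).trans (descent_simLE
    (((hred j m).2 p).1 (hm m hmn)) (((hred k 0).2 p).1 hk) ?_)).trans (h2 k 0)) hs
  by_contra hlt
  rw [not_le] at hlt
  -- Taking α to be the code of p in entry (j, m) itself, condition (2) would put its order type
  -- strictly below itself.
  obtain ⟨_, hself⟩ := hch j k hjk ⟨_, ((hred j m).2 p).1 (hm m hmn)⟩ m ⟨⟨_, hlt⟩, hm m hmn⟩
  exact lt_irrefl _ hself

/-! ### Evaluating the difference operator -/

theorem auxValue_succ_of_isGreatest {ℓ : ℕ} {c : Fin 2} {a : Fin ℓ → ℕ → Fin 2}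
    {A : Fin ℓ → ℕ → Set Baire} {x : Baire} {k : Fin ℓ} {m : ℕ}
    (h : IsGreatest {n | x ∈ A k n} m) : auxValue c a A x k.succ = a k m := by
  have hex : ∃ m, IsGreatest {n | x ∈ A k n} m := ⟨m, h⟩
  simp only [auxValue, Fin.induction_succ]
  rw [dif_pos hex, hex.choose_spec.unique h]

theorem auxValue_succ_of_not_exists {ℓ : ℕ} {c : Fin 2} {a : Fin ℓ → ℕ → Fin 2}
    {A : Fin ℓ → ℕ → Set Baire} {x : Baire} {k : Fin ℓ}
    (h : ¬ ∃ m, IsGreatest {n | x ∈ A k n} m) :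
    auxValue c a A x k.succ = auxValue c a A x k.castSucc := by
  simp only [auxValue, Fin.induction_succ]
  rw [dif_neg h]

theorem diffOp_of_isLeast {ℓ : ℕ} {c : Fin 2} {a : Fin ℓ → ℕ → Fin 2}
    {A : Fin ℓ → ℕ → Set Baire} {x : Baire} {k : Fin ℓ}
    (h : IsLeast {j : Fin ℓ | x ∈ ⋂ n, A j n} k) :
    diffOp c a A x = auxValue c a A x k.castSucc := by
  have hex : ∃ k, IsLeast {j : Fin ℓ | x ∈ ⋂ n, A j n} k := ⟨k, h⟩
  rw [diffOp, dif_pos hex, hex.choose_spec.unique h]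

theorem exists_isLeast_of_mem {ℓ : ℕ} {s : Set (Fin ℓ)} {j : Fin ℓ} (h : j ∈ s) :
    ∃ k, IsLeast s k := by
  obtain ⟨k, hk, hmin⟩ := wellFounded_lt.has_min s ⟨j, h⟩
  exact ⟨k, hk, fun i hi => not_lt.1 (hmin i hi)⟩

theorem diffOp_of_forall_notMem {ℓ : ℕ} {c : Fin 2} {a : Fin ℓ → ℕ → Fin 2}
    {A : Fin ℓ → ℕ → Set Baire} {x : Baire} (h : ∀ j, x ∉ ⋂ n, A j n) :
    diffOp c a A x = auxValue c a A x (Fin.last ℓ) := by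
  rw [diffOp, dif_neg]
  rintro ⟨k, hk, -⟩
  exact h k hk

theorem auxValue_congr {ℓ : ℕ} {c : Fin 2} {a : Fin ℓ → ℕ → Fin 2} {A B : Fin ℓ → ℕ → Set Baire}
    {x : Baire} (h : ∀ j n, x ∈ A j n ↔ x ∈ B j n) (k : Fin (ℓ + 1)) :
    auxValue c a A x k = auxValue c a B x k := by
  induction k using Fin.induction with
  | zero => rfl
  | succ k ih =>
    have hs : {n | x ∈ A k n} = {n | x ∈ B k n} := Set.ext fun n => h k n
    by_cases hm : ∃ m, IsGreatest {n | x ∈ A k n} m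
    · obtain ⟨m, hm⟩ := hm
      rw [auxValue_succ_of_isGreatest hm, auxValue_succ_of_isGreatest (hs ▸ hm)]
    · rw [auxValue_succ_of_not_exists hm, auxValue_succ_of_not_exists (hs ▸ hm), ih]

theorem diffOp_congr {ℓ : ℕ} {c : Fin 2} {a : Fin ℓ → ℕ → Fin 2} {A B : Fin ℓ → ℕ → Set Baire}
    {x : Baire} (h : ∀ j n, x ∈ A j n ↔ x ∈ B j n) : diffOp c a A x = diffOp c a B x := by
  have hs : ∀ j, x ∈ ⋂ n, A j n ↔ x ∈ ⋂ n, B j n := fun j => by simp only [Set.mem_iInter, h]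
  by_cases hj : ∃ j, x ∈ ⋂ n, A j n
  · obtain ⟨j, hj⟩ := hj
    obtain ⟨k, hk⟩ := exists_isLeast_of_mem (s := {j | x ∈ ⋂ n, A j n}) hj
    rw [diffOp_of_isLeast hk, diffOp_of_isLeast (k := k) (by simpa only [← hs] using hk),
      auxValue_congr h]
  · rw [not_exists] at hj
    rw [diffOp_of_forall_notMem hj, diffOp_of_forall_notMem (by simpa only [← hs] using hj),
      auxValue_congr h]

/-! ### Monotonicity and complements -/

/-- The code of the usual order of `ℕ`. -/
def natCode (p : ℕ × ℕ) : Bool := decide (p.1 ≤ p.2)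

theorem codeLT_natCode : codeLT natCode = (· < ·) := by
  ext a b
  simp [codeLT, natCode, lt_iff_le_and_ne]

theorem natCode_mem_WO : natCode ∈ WO := by
  refine ⟨fun a => by simp [natCode], ?_⟩
  rw [codeLT_natCode]
  infer_instance

theorem otype_natCode_le (y : WO) : WO.otype ⟨natCode, natCode_mem_WO⟩ ≤ WO.otype y := by
  have h1 : WO.otype ⟨natCode, natCode_mem_WO⟩ = Ordinal.omega0 := by
    rw [← Ordinal.type_nat_lt]
    unfold WO.otype
    congr 1
    exact codeLT_natCode
  have := y.2.2
  rw [h1, WO.otype, ← not_lt, Ordinal.lt_omega0]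
  rintro ⟨n, hn⟩
  have := congrArg Ordinal.card hn
  rw [Ordinal.card_type, Ordinal.card_nat] at this
  rw [Cardinal.mk_nat] at this
  exact (Cardinal.natCast_lt_aleph0 (n := n)).ne this.symm

theorem const_false_notMem_WO : (fun _ => false : ℕ × ℕ → Bool) ∉ WO := fun h => by
  have := h.1 0
  cases this

theorem reducesToWO_univ : ReducesToWO (fun _ => natCode) Set.univ :=
  ⟨continuous_const, fun _ => iff_of_true trivial natCode_mem_WO⟩

theorem reducesToWO_empty : ReducesToWO (fun _ _ => false) ∅ :=
  ⟨continuous_const, fun _ => iff_of_false id const_false_notMem_WO⟩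

theorem isPi11_empty : IsPi11 (∅ : Set Baire) := by
  rw [IsPi11, Set.compl_empty]
  exact isClosed_univ.analyticSet

theorem isPi11_univ : IsPi11 (Set.univ : Set Baire) := by
  rw [IsPi11, Set.compl_univ]
  exact isClosed_empty.analyticSet

/-- An appended empty row has no stages and no maximum, so it changes neither condition (2) nor the
final value. -/
theorem dPrime_subset_succ (ℓ : ℕ) : DPrime ℓ ⊆ DPrime (ℓ + 1) := by
  rintro _ ⟨A, ⟨hpi, hanti, o, hred, hch⟩, rfl⟩
  refine ⟨Fin.snoc (α := fun _ => ℕ → Set Baire) A fun _ => ∅,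
    ⟨?_, ?_, Fin.snoc (α := fun _ => ℕ → Baire → ℕ × ℕ → Bool) o fun _ _ _ => false, ?_, ?_⟩, ?_⟩
  · intro j n
    induction j using Fin.lastCases with
    | last => simpa using isPi11_empty
    | cast j => simpa using hpi j n
  · intro j
    induction j using Fin.lastCases with
    | last => simpa using antitone_const
    | cast j => simpa using hanti j
  · intro j n
    induction j using Fin.lastCases with
    | last => simpa using reducesToWO_empty
    | cast j => simpa using hred j n
  · intro j k hjk α n
    induction k using Fin.lastCases with
    | last =>
      rintro x ⟨⟨h, -⟩, -⟩
      rw [Fin.snoc_last] at h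
      exact absurd h const_false_notMem_WO
    | cast k =>
      induction j using Fin.lastCases with
      | last => exact absurd hjk (not_lt.2 (Fin.le_last _))
      | cast j => simpa using hch j k (Fin.castSucc_lt_castSucc_iff.1 hjk) α n
  · ext x
    set A' : Fin (ℓ + 1) → ℕ → Set Baire :=
      Fin.snoc (α := fun _ => ℕ → Set Baire) A fun _ => ∅ with hA'
    have hlast : A' (Fin.last ℓ) = fun _ => ∅ := by simp [hA']
    have hcast : ∀ j : Fin ℓ, A' j.castSucc = A j := fun j => by simp [hA']
    have haux : ∀ k : Fin (ℓ + 1), auxValue 0 (fun _ n => par n) A' x k.castSucc =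
        auxValue 0 (fun _ n => par n) A x k := by
      intro k
      induction k using Fin.induction with
      | zero => rfl
      | succ k ih =>
        rw [← Fin.succ_castSucc]
        by_cases h : ∃ m, IsGreatest {n | x ∈ A k n} m
        · obtain ⟨m, hm⟩ := h
          rw [auxValue_succ_of_isGreatest hm, auxValue_succ_of_isGreatest (m := m)]
          rwa [hcast]
        · rw [auxValue_succ_of_not_exists h, auxValue_succ_of_not_exists, ih]
          rwa [hcast]
    have hdiff : diffOp 0 (fun _ n => par n) A' x = diffOp 0 (fun _ n => par n) A x := by
      by_cases h : ∃ j, x ∈ ⋂ n, A j n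
      · obtain ⟨j, hj⟩ := h
        obtain ⟨k, hk⟩ := exists_isLeast_of_mem (s := {j | x ∈ ⋂ n, A j n}) hj
        rw [diffOp_of_isLeast hk, diffOp_of_isLeast (k := k.castSucc), haux]
        refine ⟨by simpa [hcast] using hk.1, fun i hi => ?_⟩
        induction i using Fin.lastCases with
        | last => exact Fin.le_last _
        | cast i =>
          refine Fin.castSucc_le_castSucc_iff.2 (hk.2 ?_)
          simpa [hcast] using hi
      · rw [not_exists] at h
        rw [diffOp_of_forall_notMem h, diffOp_of_forall_notMem, ← Fin.succ_last,
          auxValue_succ_of_not_exists, haux]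
        · rintro ⟨m, hm, -⟩
          rw [Set.mem_ofPred_eq, hlast] at hm
          exact hm
        · intro j
          induction j using Fin.lastCases with
          | last => simp [hlast]
          | cast j => simpa [hcast] using h j
    rw [Set.mem_ofPred_eq, Set.mem_ofPred_eq, hdiff]

theorem monotone_dPrime : Monotone DPrime := monotone_nat_of_le_succ dPrime_subset_succ

theorem par_succ (n : ℕ) : par (n + 1) = 1 - par n := by
  unfold par
  rcases Nat.even_or_odd n with h | h
  · simp [h.add_one, Nat.not_odd_iff_even.2 h]
  · simp [h, Nat.not_odd_iff_even.2 h.add_one]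

/-- The matrix that computes the complement of the set computed by `A`. -/
def complMatrix {ℓ : ℕ} (A : Fin ℓ → ℕ → Set Baire) : Fin (ℓ + 1) → ℕ → Set Baire :=
  Fin.cons (α := fun _ => ℕ → Set Baire) (fun n => {_x | n ≤ 1}) fun j n => A j (n - 1)

/-- Points enter the new row 0 with order type ω, the least possible, so condition (2) holds against
all later rows. -/
theorem isOmegaChangeMatrix_complMatrix {ℓ : ℕ} {A : Fin ℓ → ℕ → Set Baire}
    (hA : IsOmegaChangeMatrix A) : IsOmegaChangeMatrix (complMatrix A) := by
  obtain ⟨hpi, hanti, o, hred, hch⟩ := hA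
  unfold complMatrix
  refine ⟨?_, ?_, Fin.cons (α := fun _ => ℕ → Baire → ℕ × ℕ → Bool)
    (fun n _ => if n ≤ 1 then natCode else fun _ => false) fun j n => o j (n - 1), ?_, ?_⟩
  · intro j n
    induction j using Fin.cases with
    | zero =>
      by_cases h : n ≤ 1
      · simpa [h] using isPi11_univ
      · simpa [h] using isPi11_empty
    | succ j => simpa using hpi j (n - 1)
  · intro j
    induction j using Fin.cases with
    | zero => exact fun n m hnm x hx => le_trans hnm hx
    | succ j => exact fun n m hnm => hanti j (Nat.sub_le_sub_right hnm 1)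
  · intro j n
    induction j using Fin.cases with
    | zero =>
      by_cases h : n ≤ 1
      · simpa [h] using reducesToWO_univ
      · simpa [h] using reducesToWO_empty
    | succ j => simpa using hred j (n - 1)
  · intro j k hjk α n
    induction k using Fin.cases with
    | zero => exact absurd hjk (Fin.not_lt_zero j)
    | succ k =>
      induction j using Fin.cases with
      | zero =>
        rintro x ⟨⟨h, hα⟩, hn⟩
        have hn1 : n ≤ 1 := hn
        have hle := (otype_natCode_le _).trans_lt hα
        simpa [stage, hn1, natCode_mem_WO] using hle
      | succ j => simpa using hch j k (Fin.succ_lt_succ_iff.1 hjk) α (n - 1)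

theorem isGreatest_sub_one {S : Set ℕ} {m : ℕ} (h : IsGreatest S m) :
    IsGreatest {n | n - 1 ∈ S} (m + 1) :=
  ⟨h.1, fun _ hn => Nat.sub_le_iff_le_add.1 (h.2 hn)⟩

theorem exists_isGreatest_of_sub_one {S : Set ℕ} {m : ℕ} (h : IsGreatest {n | n - 1 ∈ S} m) :
    ∃ m, IsGreatest S m :=
  ⟨m - 1, h.1, fun n hn => Nat.le_sub_one_of_lt (h.2 (show n + 1 - 1 ∈ S from hn))⟩

/-- The new row has maximum 1, replacing the initial value 0 by 1. Repeating column 0 in the other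
rows raises every maximum by one and flips its parity, while full intersections are unchanged. -/
theorem diffOp_complMatrix {ℓ : ℕ} (A : Fin ℓ → ℕ → Set Baire) (x : Baire) :
    diffOp 0 (fun _ n => par n) (complMatrix A) x = 1 - diffOp 0 (fun _ n => par n) A x := by
  have hsucc : ∀ (j : Fin ℓ) n, complMatrix A j.succ n = A j (n - 1) := fun _ _ => rfl
  have hmem : ∀ j : Fin ℓ, x ∈ ⋂ n, complMatrix A j.succ n ↔ x ∈ ⋂ n, A j n := by
    intro j
    simp only [Set.mem_iInter, hsucc]
    exact ⟨fun h n => h (n + 1), fun h n => h _⟩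
  have hzero : x ∉ ⋂ n, complMatrix A 0 n := fun h =>
    absurd (show 2 ≤ 1 from Set.mem_iInter.1 h 2) (by norm_num)
  have haux : ∀ k : Fin (ℓ + 1), auxValue 0 (fun _ n => par n) (complMatrix A) x k.succ =
      1 - auxValue 0 (fun _ n => par n) A x k := by
    intro k
    induction k using Fin.induction with
    | zero =>
      have h : IsGreatest {n | x ∈ complMatrix A 0 n} 1 :=
        ⟨show 1 ≤ 1 from le_rfl, fun n (hn : n ≤ 1) => hn⟩
      rw [auxValue_succ_of_isGreatest h]
      rfl
    | succ k ih =>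
      by_cases h : ∃ m, IsGreatest {n | x ∈ A k n} m
      · obtain ⟨m, hm⟩ := h
        rw [auxValue_succ_of_isGreatest hm,
          auxValue_succ_of_isGreatest (m := m + 1) (isGreatest_sub_one hm), par_succ]
      · rw [auxValue_succ_of_not_exists h, auxValue_succ_of_not_exists, ← Fin.succ_castSucc, ih]
        rintro ⟨m, hm⟩
        exact h (exists_isGreatest_of_sub_one (S := {n | x ∈ A k n}) hm)
  by_cases h : ∃ j, x ∈ ⋂ n, A j n
  · obtain ⟨j, hj⟩ := h
    obtain ⟨k, hk⟩ := exists_isLeast_of_mem (s := {j | x ∈ ⋂ n, A j n}) hj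
    rw [diffOp_of_isLeast hk, diffOp_of_isLeast (k := k.succ), ← Fin.succ_castSucc, haux]
    refine ⟨(hmem k).2 hk.1, fun i hi => ?_⟩
    induction i using Fin.cases with
    | zero => exact absurd hi hzero
    | succ i => exact Fin.succ_le_succ_iff.2 (hk.2 ((hmem i).1 hi))
  · rw [not_exists] at h
    rw [diffOp_of_forall_notMem h, diffOp_of_forall_notMem, ← Fin.succ_last, haux]
    intro j
    induction j using Fin.cases with
    | zero => exact hzero
    | succ j => exact fun hj => h j ((hmem j).1 hj)

theorem compl_mem_dPrime_succ {ℓ : ℕ} {P : Set Baire} (hP : P ∈ DPrime ℓ) :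
    Pᶜ ∈ DPrime (ℓ + 1) := by
  obtain ⟨A, hA, rfl⟩ := hP
  refine ⟨complMatrix A, isOmegaChangeMatrix_complMatrix hA, ?_⟩
  ext x
  rw [Set.mem_compl_iff, Set.mem_ofPred_eq, Set.mem_ofPred_eq, diffOp_complMatrix]
  generalize diffOp 0 (fun _ n => par n) A x = v
  revert v
  decide

theorem exists_mem_dPrime_compl_notMem (ℓ : ℕ) : ∃ P ∈ DPrime ℓ, Pᶜ ∉ DPrime ℓ := by
  refine ⟨_, ⟨universalMatrix ℓ, isOmegaChangeMatrix_universalMatrix ℓ, rfl⟩, ?_⟩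
  rintro ⟨B, hB, hcompl⟩
  obtain ⟨p, hp⟩ := exists_mem_universalMatrix_iff hB
  have h := Set.ext_iff.1 hcompl p
  rw [Set.mem_compl_iff, Set.mem_ofPred_eq, Set.mem_ofPred_eq, diffOp_congr hp] at h
  exact not_iff_self h

theorem lemma5p7 (k ℓ : ℕ) (hkℓ : k < ℓ) : (DPrime ℓ \ DPrime k).Nonempty := by
  obtain ⟨P, hP, hPc⟩ := exists_mem_dPrime_compl_notMem k
  exact ⟨Pᶜ, monotone_dPrime hkℓ (compl_mem_dPrime_succ hP), hPc⟩
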